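/- **Theorem 5 (Wasserstein uncertainty set).** Let $\mathcal S$ (a finite metric space with metric $d$) and $\mathcal A$ be finite non-empty state and action sets, $H$ a horizon, $r_h:\mathcal S\times\mathcal A\to[0,1]$ $(1\le h\le H)$ known rewards, and $P^o_{h,s,a}$ unknown nominal next-state distributions on $\mathcal S$. Let $p\in[1,\infty)$, $\rho>0$, $B_p=\max_{s,s'}d(s,s')^p$, and $$W_p(P,Q)=\Big(\inf_{\nu}\int d^p(x,y)\,d\nu(x,y)\Big)^{1/p},$$ the infimum being over all probability measures $\nu$ on $\mathcal S\times\mathcal S$ with marginals $P$ and $Q$. Let $\mathcal P=\bigotimes_{h,s,a}\mathcal P_{h,s,a}$ with $\mathcal P_{h,s,a}=\{P\in\Delta(\mathcal S):W_p(P,P^o_{h,s,a})\le\rho\}$. For a deterministic non-stationary Markov policy $\pi=(\pi_h)_{h=1}^H$ let $$V^\pi(s)=\inf_{P\in\mathcal P}\mathbb E_{\pi,P}\Big[\sum_{h=1}^H r_h(s_h,a_h)\,\Big|\,s_1=s\Big],\qquad V^*(s)=\sup_\pi V^\pi(s).$$ The algorithm RPVL (Robust Phased Value Learning) draws, for each $(h,s,a)$,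 $N$ samples from $P^o_{h,s,a}$, all samples being independent, so that the total number of samples is $N_{\mathrm{total}}=N|\mathcal S||\mathcal A|H$. It forms the empirical frequencies $\widehat P^o_{h,s,a}$ and $\widehat{\mathcal P}_{h,s,a}=\{P\in\Delta(\mathcal S):W_p(P,\widehat P^o_{h,s,a})\le\rho\}$, sets $\widehat V_{H+1}=0$ and, for $h=H,\dots,1$, $$\widehat V_h(s)=\max_a\Big\{r_h(s,a)+\inf_{P\in\widehat{\mathcal P}_{h,s,a}}\sum_{s'}P(s')\widehat V_{h+1}(s')\Big\},$$ and outputs a policy $\widehat\pi=(\widehat\pi_h)_{h=1}^H$ in which $\widehat\pi_h(s)$ is a maximizing action (with any tie-breaking). Fix $\delta\in(0,1)$ and $\epsilon\in(0,H)$. If $N_{\mathrm{total}}\ge N_{\mathrm W}$, where $$N_{\mathrm W}=\frac{8H^5|\mathcal S||\mathcal A|(B_p+\rho^p)^2}{\rho^{2p}\epsilon^2}\cdot\log\frac{16H^2|\mathcal S||\mathcal A|\big(HB_p+\max(H,\rho^p)\big)}{\rho^p\,\delta\,\epsilon},$$ then, with probability at least $1-\delta$, $\ \|V^*-V^{\widehat\pi}\|_\infty\le\epsilon$.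 -/

import Mathlib

open scoped BigOperators

noncomputable section

namespace RPVL

variable {S A : Type*} {H N : ℕ}

/-- `ν` is a probability vector on `S × S` with first marginal `P` and second marginal `Q`. -/
def IsCoupling [Fintype S] (ν : S × S → ℝ) (P Q : S → ℝ) : Prop :=
  ν ∈ stdSimplex ℝ (S × S) ∧ (∀ x, ∑ y, ν (x, y) = P x) ∧ (∀ y, ∑ x, ν (x, y) = Q y)

/-- The optimal transport cost `inf_ν ∫ d(x,y)^p dν(x,y)` over the couplings of `P` and `Q`. -/
def transportCost [Fintype S] [MetricSpace S] (p : ℝ) (P Q : S → ℝ) : ℝ :=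
  sInf {c : ℝ | ∃ ν : S × S → ℝ, IsCoupling ν P Q ∧ c = ∑ z, dist z.1 z.2 ^ p * ν z}

/-- The `p`-Wasserstein distance between two probability vectors. -/
def wasserstein [Fintype S] [MetricSpace S] (p : ℝ) (P Q : S → ℝ) : ℝ :=
  transportCost p P Q ^ (1 / p)

/-- The `p`-Wasserstein ball of radius `ρ` around `Q` in the probability simplex. -/
def wassersteinBall [Fintype S] [MetricSpace S] (p ρ : ℝ) (Q : S → ℝ) : Set (S → ℝ) :=
  {P | P ∈ stdSimplex ℝ S ∧ wasserstein p P Q ≤ ρ}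

/-- `B_p = max_{s,s'} d(s,s')^p`. -/
def maxDistPow (S : Type*) [MetricSpace S] (p : ℝ) : ℝ :=
  ⨆ z : S × S, dist z.1 z.2 ^ p

/-- A (time-dependent) transition model: `P h s a s'` is the probability of moving to `s'` when
action `a` is taken in state `s` at step `h`. The `H` steps are indexed by `Fin H`. -/
abbrev Model (S A : Type*) (H : ℕ) : Type _ := Fin H → S → A → S → ℝ

/-- Deterministic non-stationary Markov policies. -/
abbrev Policy (S A : Type*) (H : ℕ) : Type _ := Fin H → S → A

/-- The `(s,a)`-rectangular uncertainty set: the product over all `(h,s,a)` of the Wasserstein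
balls around the given model. -/
def uncertaintySet [Fintype S] [MetricSpace S] (p ρ : ℝ) (P₀ : Model S A H) :
    Set (Model S A H) :=
  {P | ∀ h s a, P h s a ∈ wassersteinBall p ρ (P₀ h s a)}

/-- The probability of the trajectory `x 0, x 1, …, x H` of states, given its initial state, when
policy `π` is used in model `P`. -/
def trajProb (P : Model S A H) (π : Policy S A H) (x : Fin (H + 1) → S) : ℝ :=
  ∏ h : Fin H, P h (x h.castSucc) (π h (x h.castSucc)) (x h.succ)

/-- The total reward collected along a trajectory. -/
def totalReward (r : Fin H → S → A → ℝ) (π : Policy S A H) (x : Fin (H + 1) → S) : ℝ :=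
  ∑ h : Fin H, r h (x h.castSucc) (π h (x h.castSucc))

/-- The value (from the first step on) of `π` in model `P`: the expected total reward over the
trajectories that start in `s`. -/
def value [Fintype S] (r : Fin H → S → A → ℝ) (P : Model S A H) (π : Policy S A H) (s : S) : ℝ :=
  ∑ y : Fin H → S,
    trajProb P π (Fin.cons s y : Fin (H + 1) → S) *
      totalReward r π (Fin.cons s y : Fin (H + 1) → S)

/-- The robust value of `π`: the worst case over the uncertainty set around `P₀`. -/
def robustValue [Fintype S] [MetricSpace S] (p ρ : ℝ) (r : Fin H → S → A → ℝ)
    (P₀ : Model S A H) (π : Policy S A H) (s : S) : ℝ :=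
  sInf ((fun P => value r P π s) '' uncertaintySet p ρ P₀)

/-- The optimal robust value. -/
def optRobustValue [Fintype S] [MetricSpace S] (p ρ : ℝ) (r : Fin H → S → A → ℝ)
    (P₀ : Model S A H) (s : S) : ℝ :=
  ⨆ π : Policy S A H, robustValue p ρ r P₀ π s

/-- `L_K V = inf {P V : P ∈ K}`. -/
def worstCase [Fintype S] (K : Set (S → ℝ)) (V : S → ℝ) : ℝ :=
  sInf ((fun P : S → ℝ => ∑ s, P s * V s) '' K)

open Classical in
/-- The maximum likelihood estimate of the model: `D h s a i` is the `i`-th sampled next state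
for `(h,s,a)`, and the estimate is the frequency of `s'` among the `N` samples. -/
def empiricalModel (D : Fin H → S → A → Fin N → S) : Model S A H :=
  fun h s a s' => ((Finset.univ.filter fun i => D h s a i = s').card : ℝ) / N

/-- One-step robust look-ahead `r_h(s,a) + L_{𝒫_{h,s,a}} V`, with `𝒫_{h,s,a}` the ball around
`P₀ h s a`. -/
def robustQ [Fintype S] [MetricSpace S] (p ρ : ℝ) (r : Fin H → S → A → ℝ)
    (P₀ : Model S A H) (h : Fin H) (V : S → ℝ) (s : S) (a : A) : ℝ :=
  r h s a + worstCase (wassersteinBall p ρ (P₀ h s a)) V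

/-- Robust backward induction: the value after the last step is `0`, and
`V_h(s) = max_a (r_h(s,a) + L_{𝒫_{h,s,a}} V_{h+1})`. -/
def robustDP [Fintype S] [MetricSpace S] (p ρ : ℝ) (r : Fin H → S → A → ℝ)
    (P₀ : Model S A H) (h : Fin (H + 1)) : S → ℝ :=
  Fin.reverseInduction (motive := fun _ => S → ℝ) (fun _ => 0)
    (fun h V s => ⨆ a : A, robustQ p ρ r P₀ h V s a) h

/-- `π` is an output of Robust Phased Value Learning on the data `D`: at every step and state it
picks a maximizer (with any tie-breaking) in the robust backward induction for the empirical
model. -/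
def IsOutput [Fintype S] [MetricSpace S] (p ρ : ℝ) (r : Fin H → S → A → ℝ)
    (D : Fin H → S → A → Fin N → S) (π : Policy S A H) : Prop :=
  ∀ h s a,
    robustQ p ρ r (empiricalModel D) h (robustDP p ρ r (empiricalModel D) h.succ) s a ≤
      robustQ p ρ r (empiricalModel D) h (robustDP p ρ r (empiricalModel D) h.succ) s (π h s)

/-- The sample size `N_W` of the bound; `nS`, `nA` are the numbers of states and actions and `B`
is `B_p`. -/
def sampleBound (H nS nA B p ρ δ ε : ℝ) : ℝ :=
  8 * H ^ 5 * nS * nA * (B + ρ ^ p) ^ 2 / (ρ ^ (2 * p) * ε ^ 2) *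
    Real.log (16 * H ^ 2 * nS * nA * (H * B + max H (ρ ^ p)) / (ρ ^ p * δ * ε))

end RPVL

end

open scoped BigOperators

noncomputable section

namespace RPVL

variable {S A : Type*} {H N : ℕ}

/-! The engine is duality. Minimizing `P V` over a Wasserstein ball around `P₀` is a linear program
over couplings with second marginal `P₀` and one cost constraint. Its dual is one-dimensional:
maximize `P₀ (cTransform V l) - l ρ^p` over `l ≥ 0`, and for `0 ≤ V ≤ H` some optimal `l` lies in
`[0, H/ρ^p]` (`dual_le_worstCase`, `exists_worstCase_le_dual`). Two balls therefore have close worst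
cases as soon as their centers give close expectations of these `c`-transforms. Since `cTransform V
l` is nondecreasing and `B_p`-Lipschitz in `l`, a finite grid of `l` suffices
(`expect_cTransform_le_of_grid`).

At each grid point Hoeffding's inequality applies with range `H`. The test function is built from
the random backward induction after step `h`, but that depends only on samples of later steps, so
one may condition on it (`measureReal_empirical_ge_le`). A union bound over steps, states, actions,
grid points and the two signs costs at most `δ`.

Off the bad event all one-step worst cases agree up to `η = t + θ B_p ≤ ε/(2H)`. The error `η`
accumulates over `H` steps, once for the optimal value and once for the greedy policy, giving `2Hη ≤
ε` (`norm_optRobustValue_sub_le`). -/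

/-! ### Lagrange multipliers -/

/-- Lagrange multipliers for one linear constraint on a convex set, with a bound on the
multiplier from a Slater point `x₀`. -/
theorem exists_multiplier {E : Type*} [AddCommGroup E] [Module ℝ E] {C : Set E}
    (hC : Convex ℝ C) (v c : E →ₗ[ℝ] ℝ) {v₀ κ M : ℝ} (hκ : 0 < κ)
    (hopt : ∀ x ∈ C, c x ≤ κ → v₀ ≤ v x) {x₀ : E} (hx₀ : x₀ ∈ C) (hc₀ : c x₀ = 0)
    (hM : v x₀ - v₀ ≤ M) :
    ∃ l ∈ Set.Icc 0 (M / κ), ∀ x ∈ C, v₀ ≤ v x + l * (c x - κ) := by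
  -- Infeasible points bound the multiplier from below, strictly feasible ones from above. `T`
  -- collects the lower bounds, with `0` for the sign, and its supremum is the multiplier.
  set T : Set ℝ := insert 0 {t | ∃ x ∈ C, κ < c x ∧ t = (v₀ - v x) / (c x - κ)} with hT
  have hub : ∀ x ∈ C, c x < κ → ∀ t ∈ T, t ≤ (v x - v₀) / (κ - c x) := by
    rintro x hx hxκ t (rfl | ⟨y, hy, hyκ, rfl⟩)
    · exact div_nonneg (sub_nonneg.2 (hopt x hx hxκ.le)) (by linarith)
    · have hpos : 0 < c y - c x := by linarith
      -- The point of the segment from `x` to `y` at which `c` equals `κ`.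
      have hmem := hC hx hy (a := (c y - κ) / (c y - c x)) (b := (κ - c x) / (c y - c x))
        (div_nonneg (by linarith) hpos.le) (div_nonneg (by linarith) hpos.le)
        (by field_simp; ring)
      have hle := hopt _ hmem (by
        simp only [map_add, map_smul, smul_eq_mul]
        apply le_of_eq; field_simp; ring)
      simp only [map_add, map_smul, smul_eq_mul] at hle
      have hle' : v₀ * (c y - c x) ≤ (c y - κ) * v x + (κ - c x) * v y := by
        calc v₀ * (c y - c x) ≤ ((c y - κ) / (c y - c x) * v x +
              (κ - c x) / (c y - c x) * v y) * (c y - c x) :=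
              mul_le_mul_of_nonneg_right hle hpos.le
          _ = _ := by field_simp
      rw [div_le_div_iff₀ (by linarith) (by linarith)]
      nlinarith
  have hub₀ : ∀ t ∈ T, t ≤ M / κ := fun t ht => by
    have := hub x₀ hx₀ (by linarith) t ht
    rw [hc₀, sub_zero] at this
    exact this.trans (by gcongr)
  have hbdd : BddAbove T := ⟨_, hub₀⟩
  have hne : T.Nonempty := ⟨0, Set.mem_insert _ _⟩
  refine ⟨sSup T, ⟨le_csSup hbdd (Set.mem_insert _ _), csSup_le hne hub₀⟩, fun x hx => ?_⟩
  rcases lt_trichotomy (c x) κ with h | h | h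
  · have := csSup_le hne (hub x hx h)
    rw [le_div_iff₀ (by linarith)] at this
    linarith
  · simpa [h] using hopt x hx h.le
  · have : (v₀ - v x) / (c x - κ) ≤ sSup T := le_csSup hbdd (Or.inr ⟨x, hx, h, rfl⟩)
    rw [div_le_iff₀ (by linarith)] at this
    linarith

/-! ### Expectations, worst cases and couplings -/

section Expectation

variable [Fintype S]

theorem expect_nonneg {P V : S → ℝ} (hP : P ∈ stdSimplex ℝ S) (hV : ∀ s, 0 ≤ V s) :
    0 ≤ ∑ s, P s * V s :=
  Finset.sum_nonneg fun s _ => mul_nonneg (hP.1 s) (hV s)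

theorem expect_le {P V : S → ℝ} {M : ℝ} (hP : P ∈ stdSimplex ℝ S) (hV : ∀ s, V s ≤ M) :
    ∑ s, P s * V s ≤ M := by
  calc ∑ s, P s * V s ≤ ∑ s, P s * M :=
        Finset.sum_le_sum fun s _ => mul_le_mul_of_nonneg_left (hV s) (hP.1 s)
    _ = M := by rw [← Finset.sum_mul, hP.2, one_mul]

theorem expect_mono {P V W : S → ℝ} (hP : P ∈ stdSimplex ℝ S) (h : ∀ s, V s ≤ W s) :
    ∑ s, P s * V s ≤ ∑ s, P s * W s :=
  Finset.sum_le_sum fun s _ => mul_le_mul_of_nonneg_left (h s) (hP.1 s)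

theorem expect_add_const {P : S → ℝ} (V : S → ℝ) (c : ℝ) (hP : P ∈ stdSimplex ℝ S) :
    ∑ s, P s * (V s + c) = ∑ s, P s * V s + c := by
  simp only [mul_add, Finset.sum_add_distrib, ← Finset.sum_mul, hP.2, one_mul]

theorem bddBelow_expect {K : Set (S → ℝ)} (hK : K ⊆ stdSimplex ℝ S) {V : S → ℝ}
    (hV : ∀ s, 0 ≤ V s) : BddBelow ((fun P : S → ℝ => ∑ s, P s * V s) '' K) :=
  ⟨0, by rintro _ ⟨P, hP, rfl⟩; exact expect_nonneg (hK hP) hV⟩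

theorem worstCase_le {K : Set (S → ℝ)} (hK : K ⊆ stdSimplex ℝ S) {V : S → ℝ}
    (hV : ∀ s, 0 ≤ V s) {P : S → ℝ} (hP : P ∈ K) : worstCase K V ≤ ∑ s, P s * V s :=
  csInf_le (bddBelow_expect hK hV) ⟨P, hP, rfl⟩

theorem worstCase_nonneg {K : Set (S → ℝ)} (hK : K ⊆ stdSimplex ℝ S) {V : S → ℝ}
    (hV : ∀ s, 0 ≤ V s) : 0 ≤ worstCase K V :=
  Real.sInf_nonneg (by rintro _ ⟨P, hP, rfl⟩; exact expect_nonneg (hK hP) hV)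

theorem exists_lt_worstCase_add {K : Set (S → ℝ)} (hne : K.Nonempty) (V : S → ℝ)
    {ξ : ℝ} (hξ : 0 < ξ) : ∃ P ∈ K, ∑ s, P s * V s < worstCase K V + ξ := by
  obtain ⟨_, ⟨P, hP, rfl⟩, h⟩ := Real.lt_sInf_add_pos (hne.image
    (fun P : S → ℝ => ∑ s, P s * V s)) hξ
  exact ⟨P, hP, h⟩

/-- The first marginal of a probability vector on a product is a probability vector. -/
theorem fst_mem {ν : S × S → ℝ} (hν : ν ∈ stdSimplex ℝ (S × S)) :
    (fun x => ∑ y, ν (x, y)) ∈ stdSimplex ℝ S :=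
  ⟨fun x => Finset.sum_nonneg fun y _ => hν.1 _, by rw [← Fintype.sum_prod_type]; exact hν.2⟩

theorem isCoupling_mul {P Q : S → ℝ} (hP : P ∈ stdSimplex ℝ S) (hQ : Q ∈ stdSimplex ℝ S) :
    IsCoupling (fun z => P z.1 * Q z.2) P Q := by
  refine ⟨⟨fun z => mul_nonneg (hP.1 _) (hQ.1 _), ?_⟩, fun x => ?_, fun y => ?_⟩
  · rw [Fintype.sum_prod_type, ← Fintype.sum_mul_sum, hP.2, hQ.2, one_mul]
  · simp only [← Finset.mul_sum, hQ.2, mul_one]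
  · simp only [← Finset.sum_mul, hP.2, one_mul]

open Classical in
/-- The law of `(T X, X)` when `X` has law `P`. -/
def graphCoupling (T : S → S) (P : S → ℝ) (z : S × S) : ℝ := if z.1 = T z.2 then P z.2 else 0

theorem sum_mul_graphCoupling (T : S → S) (P : S → ℝ) (f : S × S → ℝ) :
    ∑ z, f z * graphCoupling T P z = ∑ y, f (T y, y) * P y := by
  rw [Fintype.sum_prod_type_right]
  refine Finset.sum_congr rfl fun y _ => ?_
  rw [Finset.sum_eq_single (T y) (fun x _ hx => by simp [graphCoupling, hx]) (by simp)]
  simp [graphCoupling]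

theorem graphCoupling_snd (T : S → S) (P : S → ℝ) (y : S) :
    ∑ x, graphCoupling T P (x, y) = P y := by
  rw [Finset.sum_eq_single (T y) (fun x _ hx => by simp [graphCoupling, hx]) (by simp)]
  simp [graphCoupling]

theorem graphCoupling_mem (T : S → S) {P : S → ℝ} (hP : P ∈ stdSimplex ℝ S) :
    graphCoupling T P ∈ stdSimplex ℝ (S × S) := by
  constructor
  · intro z
    unfold graphCoupling
    split_ifs
    · exact hP.1 _
    · exact le_rfl
  · rw [Fintype.sum_prod_type_right]
    simp_rw [graphCoupling_snd]
    exact hP.2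

end Expectation

theorem maxDistPow_nonneg {S : Type*} [MetricSpace S] (p : ℝ) : 0 ≤ maxDistPow S p :=
  Real.iSup_nonneg fun z => by positivity

/-! ### Wasserstein balls and their dual -/

section Transport

variable [Fintype S] [MetricSpace S]

theorem wassersteinBall_subset (p ρ : ℝ) (P : S → ℝ) :
    wassersteinBall p ρ P ⊆ stdSimplex ℝ S := fun _ h => h.1

theorem cost_nonneg (p : ℝ) {ν : S × S → ℝ} (hν : ν ∈ stdSimplex ℝ (S × S)) :
    0 ≤ ∑ z, dist z.1 z.2 ^ p * ν z :=
  Finset.sum_nonneg fun z _ => mul_nonneg (by positivity) (hν.1 z)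

theorem transportCost_nonneg (p : ℝ) (P Q : S → ℝ) : 0 ≤ transportCost p P Q :=
  Real.sInf_nonneg (by rintro _ ⟨ν, hν, rfl⟩; exact cost_nonneg p hν.1)

theorem transportCost_le (p : ℝ) {P Q : S → ℝ} {ν : S × S → ℝ} (hν : IsCoupling ν P Q) :
    transportCost p P Q ≤ ∑ z, dist z.1 z.2 ^ p * ν z :=
  csInf_le ⟨0, by rintro _ ⟨ν, hν, rfl⟩; exact cost_nonneg p hν.1⟩ ⟨ν, hν, rfl⟩

theorem wasserstein_le_iff {p ρ : ℝ} (hp : 0 < p) (hρ : 0 ≤ ρ) (P Q : S → ℝ) :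
    wasserstein p P Q ≤ ρ ↔ transportCost p P Q ≤ ρ ^ p := by
  rw [wasserstein, one_div, Real.rpow_inv_le_iff_of_pos (transportCost_nonneg p P Q) hρ hp]

/-- Any coupling of small cost will do, optimal or not. This turns optimization over the ball into
optimization over couplings whose first marginal is free. -/
theorem fst_mem_wassersteinBall {p ρ : ℝ} (hp : 0 < p) (hρ : 0 ≤ ρ) {P : S → ℝ}
    {ν : S × S → ℝ} (hν : ν ∈ stdSimplex ℝ (S × S)) (hsnd : ∀ y, ∑ x, ν (x, y) = P y)
    (hc : ∑ z, dist z.1 z.2 ^ p * ν z ≤ ρ ^ p) :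
    (fun x => ∑ y, ν (x, y)) ∈ wassersteinBall p ρ P :=
  ⟨fst_mem hν, (wasserstein_le_iff hp hρ _ _).2
    ((transportCost_le p ⟨hν, fun _ => rfl, hsnd⟩).trans hc)⟩

theorem cost_graphCoupling_id {p : ℝ} (hp : 0 < p) (P : S → ℝ) :
    ∑ z, dist z.1 z.2 ^ p * graphCoupling id P z = 0 := by
  rw [sum_mul_graphCoupling]
  simp [Real.zero_rpow hp.ne']

theorem wassersteinBall_nonempty {p ρ : ℝ} (hp : 0 < p) (hρ : 0 ≤ ρ) {P : S → ℝ}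
    (hP : P ∈ stdSimplex ℝ S) : (wassersteinBall p ρ P).Nonempty :=
  ⟨_, fst_mem_wassersteinBall hp hρ (graphCoupling_mem id hP) (graphCoupling_snd id P)
    (by rw [cost_graphCoupling_id hp]; positivity)⟩

/-- The `c`-transform of `V` for the cost `l * d ^ p`. -/
def cTransform (p : ℝ) (V : S → ℝ) (l : ℝ) (y : S) : ℝ := ⨅ x, (V x + l * dist x y ^ p)

theorem cTransform_le (p : ℝ) (V : S → ℝ) (l : ℝ) (x y : S) :
    cTransform p V l y ≤ V x + l * dist x y ^ p :=
  ciInf_le (Set.finite_range _).bddBelow x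

theorem exists_cTransform_eq [Nonempty S] (p : ℝ) (V : S → ℝ) (l : ℝ) (y : S) :
    ∃ x, V x + l * dist x y ^ p = cTransform p V l y :=
  exists_eq_ciInf_of_finite

/-- Taking `x = y` costs nothing, so the upper bound does not grow with `l`; Hoeffding can then use
the same range at every grid point. -/
theorem cTransform_mem_Icc [Nonempty S] {p : ℝ} (hp : 0 < p) {V : S → ℝ} {M : ℝ}
    (hV : ∀ s, V s ∈ Set.Icc 0 M) {l : ℝ} (hl : 0 ≤ l) (y : S) :
    cTransform p V l y ∈ Set.Icc 0 M := by
  constructor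
  · obtain ⟨x, hx⟩ := exists_cTransform_eq p V l y
    rw [← hx]
    have := (hV x).1
    positivity
  · have := cTransform_le p V l y y
    rw [dist_self, Real.zero_rpow hp.ne', mul_zero, add_zero] at this
    exact this.trans (hV y).2

theorem dist_rpow_le_maxDistPow (p : ℝ) (x y : S) : dist x y ^ p ≤ maxDistPow S p :=
  le_ciSup (f := fun z : S × S => dist z.1 z.2 ^ p) (Set.finite_range _).bddAbove (x, y)

theorem cTransform_mono [Nonempty S] (p : ℝ) (V : S → ℝ) {l m : ℝ} (h : l ≤ m) (y : S) :
    cTransform p V l y ≤ cTransform p V m y := by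
  obtain ⟨x, hx⟩ := exists_cTransform_eq p V m y
  rw [← hx]
  exact (cTransform_le p V l x y).trans (by gcongr)

theorem cTransform_le_add [Nonempty S] (p : ℝ) (V : S → ℝ) {l m : ℝ} (h : l ≤ m) (y : S) :
    cTransform p V m y ≤ cTransform p V l y + (m - l) * maxDistPow S p := by
  obtain ⟨x, hx⟩ := exists_cTransform_eq p V l y
  rw [← hx]
  have h1 := cTransform_le p V m x y
  have h2 := mul_le_mul_of_nonneg_left (dist_rpow_le_maxDistPow p x y) (sub_nonneg.2 h)
  linarith

/-- Weak duality for the robust expectation over a Wasserstein ball. -/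
theorem dual_le_worstCase {p ρ : ℝ} (hp : 0 < p) (hρ : 0 ≤ ρ) {P : S → ℝ}
    (hP : P ∈ stdSimplex ℝ S) (V : S → ℝ) {l : ℝ} (hl : 0 ≤ l) :
    ∑ y, P y * cTransform p V l y - l * ρ ^ p ≤ worstCase (wassersteinBall p ρ P) V := by
  refine le_csInf ((wassersteinBall_nonempty hp hρ hP).image _) ?_
  rintro _ ⟨Q, ⟨hQ, hW⟩, rfl⟩
  rw [wasserstein_le_iff hp hρ] at hW
  have key : ∀ ν, IsCoupling ν Q P →
      ∑ y, P y * cTransform p V l y ≤ ∑ x, Q x * V x + l * ∑ z, dist z.1 z.2 ^ p * ν z := by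
    rintro ν ⟨hν, h1, h2⟩
    have e1 : ∑ y, P y * cTransform p V l y = ∑ z, ν z * cTransform p V l z.2 := by
      rw [Fintype.sum_prod_type_right]
      simp_rw [← Finset.sum_mul, h2]
    have e2 : ∑ x, Q x * V x = ∑ z, ν z * V z.1 := by
      rw [Fintype.sum_prod_type]
      simp_rw [← Finset.sum_mul, h1]
    rw [e1, e2, Finset.mul_sum, ← Finset.sum_add_distrib]
    refine Finset.sum_le_sum fun z _ => ?_
    have := mul_le_mul_of_nonneg_left (cTransform_le p V l z.1 z.2) (hν.1 z)
    linarith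
  refine le_of_forall_pos_le_add fun ξ hξ => ?_
  -- A nearly optimal coupling replaces an optimal one; dividing by `l + 1` keeps the error below
  -- `ξ` after multiplication by `l`, also for `l = 0`.
  have hξ' : 0 < ξ / (l + 1) := by positivity
  obtain ⟨_, ⟨ν, hν, rfl⟩, hlt⟩ := Real.lt_sInf_add_pos
    (s := {c : ℝ | ∃ ν : S × S → ℝ, IsCoupling ν Q P ∧ c = ∑ z, dist z.1 z.2 ^ p * ν z})
    ⟨_, _, isCoupling_mul hQ hP, rfl⟩ hξ'
  have hle : ∑ z, dist z.1 z.2 ^ p * ν z ≤ ρ ^ p + ξ / (l + 1) :=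
    hlt.le.trans (add_le_add_left hW _)
  have h3 := key ν hν
  have h4 := mul_le_mul_of_nonneg_left hle hl
  have h5 : l * (ξ / (l + 1)) ≤ ξ := by
    rw [mul_div_assoc', div_le_iff₀ (by positivity)]
    nlinarith
  simp only
  linarith

/-- Strong duality for the robust expectation over a Wasserstein ball, with a bound on the
dual variable. -/
theorem exists_worstCase_le_dual [Nonempty S] {p ρ : ℝ} (hp : 0 < p) (hρ : 0 < ρ) {P : S → ℝ}
    (hP : P ∈ stdSimplex ℝ S) {V : S → ℝ} {M : ℝ} (hV : ∀ s, V s ∈ Set.Icc 0 M) :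
    ∃ l ∈ Set.Icc 0 (M / ρ ^ p),
      worstCase (wassersteinBall p ρ P) V ≤ ∑ y, P y * cTransform p V l y - l * ρ ^ p := by
  have hsum : ∀ f : S × S → ℝ, ∃ L : (S × S → ℝ) →ₗ[ℝ] ℝ, ∀ ν, L ν = ∑ z, f z * ν z := fun f =>
    ⟨Fintype.linearCombination ℝ f, fun ν => by
      simp [Fintype.linearCombination_apply, mul_comm]⟩
  obtain ⟨v, hv⟩ := hsum fun z => V z.1
  obtain ⟨c, hc⟩ := hsum fun z => dist z.1 z.2 ^ p
  -- Only the second marginal is fixed. The ball becomes the single constraint `c ν ≤ ρ ^ p`, and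
  -- the diagonal coupling, of cost zero, is the Slater point.
  set C : Set (S × S → ℝ) := {ν | ν ∈ stdSimplex ℝ (S × S) ∧ ∀ y, ∑ x, ν (x, y) = P y}
  have hC : Convex ℝ C := by
    rintro ν ⟨hν, h1⟩ ν' ⟨hν', h2⟩ a b ha hb hab
    refine ⟨convex_stdSimplex ℝ _ hν hν' ha hb hab, fun y => ?_⟩
    simp only [Pi.add_apply, Pi.smul_apply, smul_eq_mul, Finset.sum_add_distrib,
      ← Finset.mul_sum, h1, h2, ← add_mul, hab, one_mul]
  have hV0 : ∀ s, 0 ≤ V s := fun s => (hV s).1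
  obtain ⟨l, hl, hle⟩ := exists_multiplier hC v c (v₀ := worstCase (wassersteinBall p ρ P) V)
    (κ := ρ ^ p) (M := M) (by positivity)
    (by
      rintro ν ⟨hν, h2⟩ hcν
      rw [hc] at hcν
      refine (worstCase_le (wassersteinBall_subset _ _ _) hV0
        (fst_mem_wassersteinBall hp hρ.le hν h2 hcν)).trans (le_of_eq ?_)
      rw [hv, Fintype.sum_prod_type]
      simp_rw [Finset.sum_mul, mul_comm])
    (x₀ := graphCoupling id P) ⟨graphCoupling_mem id hP, graphCoupling_snd id P⟩
    (by rw [hc, cost_graphCoupling_id hp])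
    (by
      have h0 := worstCase_nonneg (wassersteinBall_subset p ρ P) hV0
      rw [hv, sum_mul_graphCoupling]
      simp only [id, mul_comm (V _)]
      have := expect_le hP fun s => (hV s).2
      linarith)
  refine ⟨l, hl, ?_⟩
  -- Moving all mass at `y` to a minimizer `T y` turns the Lagrangian into the dual objective.
  choose T hT using exists_cTransform_eq p V l
  have := hle (graphCoupling T P) ⟨graphCoupling_mem T hP, graphCoupling_snd T P⟩
  rw [hv, hc, sum_mul_graphCoupling, sum_mul_graphCoupling] at this
  simp_rw [← hT, mul_add, Finset.sum_add_distrib]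
  refine this.trans (le_of_eq ?_)
  rw [mul_sub, Finset.mul_sum, ← add_sub_assoc]
  congr 2
  · exact Finset.sum_congr rfl fun _ _ => mul_comm _ _
  · exact Finset.sum_congr rfl fun _ _ => by ring

/-- Robust expectations over two balls are close when the expectations of all `c`-transforms
under the two centers are. -/
theorem worstCase_le_add [Nonempty S] {p ρ : ℝ} (hp : 0 < p) (hρ : 0 < ρ) {P Q : S → ℝ}
    (hP : P ∈ stdSimplex ℝ S) (hQ : Q ∈ stdSimplex ℝ S) {V : S → ℝ} {M η : ℝ}
    (hV : ∀ s, V s ∈ Set.Icc 0 M)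
    (h : ∀ l ∈ Set.Icc 0 (M / ρ ^ p),
      ∑ y, P y * cTransform p V l y ≤ ∑ y, Q y * cTransform p V l y + η) :
    worstCase (wassersteinBall p ρ P) V ≤ worstCase (wassersteinBall p ρ Q) V + η := by
  obtain ⟨l, hl, hle⟩ := exists_worstCase_le_dual hp hρ hP hV
  have h1 := dual_le_worstCase hp hρ.le hQ V hl.1
  have h2 := h l hl
  linarith

/-- It is enough to compare expectations of `c`-transforms on a grid of mesh `θ`. -/
theorem expect_cTransform_le_of_grid [Nonempty S] (p : ℝ) {P Q : S → ℝ}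
    (hP : P ∈ stdSimplex ℝ S) (hQ : Q ∈ stdSimplex ℝ S) (V : S → ℝ) {θ Λ t : ℝ} (hθ : 0 < θ)
    {G : ℕ} (hG : Λ < θ * G)
    (h : ∀ j < G, ∑ y, P y * cTransform p V (θ * j) y ≤
      ∑ y, Q y * cTransform p V (θ * j) y + t) {l : ℝ} (hl : l ∈ Set.Icc 0 Λ) :
    ∑ y, P y * cTransform p V l y ≤
      ∑ y, Q y * cTransform p V l y + (t + θ * maxDistPow S p) := by
  have hdiv : 0 ≤ l / θ := div_nonneg hl.1 hθ.le
  -- Round down to the grid: the `P` side changes by at most `θ B_p`, and on the `Q` side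
  -- monotonicity makes rounding free.
  set j := ⌊l / θ⌋₊
  have h1 : θ * j ≤ l := by
    rw [mul_comm, ← le_div_iff₀ hθ]
    exact Nat.floor_le hdiv
  have h2 : l ≤ θ * j + θ := by
    have := (Nat.lt_floor_add_one (l / θ)).le
    rw [div_le_iff₀ hθ] at this
    linarith
  have hj : j < G := by
    have : θ * j < θ * G := h1.trans_lt (hl.2.trans_lt hG)
    exact_mod_cast lt_of_mul_lt_mul_left this hθ.le
  have h3 := expect_mono hP fun y => cTransform_le_add p V h1 y
  rw [expect_add_const _ _ hP] at h3
  have h4 := expect_mono hQ fun y => cTransform_mono p V h1 y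
  have h5 := mul_le_mul_of_nonneg_right (show l - θ * j ≤ θ by linarith)
    (maxDistPow_nonneg (S := S) p)
  linarith [h j hj]

end Transport

/-! ### Trajectory sums and the Bellman equation -/

theorem trajProb_cons_cons (P : Model S A (H + 1)) (π : Policy S A (H + 1)) (s s' : S)
    (y : Fin H → S) :
    trajProb P π (Fin.cons s (Fin.cons s' y : Fin (H + 1) → S)) =
      P 0 s (π 0 s) s' * trajProb (fun h => P h.succ) (fun h => π h.succ) (Fin.cons s' y) := by
  simp [trajProb, Fin.prod_univ_succ (n := H)]

theorem totalReward_cons (r : Fin (H + 1) → S → A → ℝ) (π : Policy S A (H + 1)) (s : S)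
    (y : Fin (H + 1) → S) :
    totalReward r π (Fin.cons s y) =
      r 0 s (π 0 s) + totalReward (fun h => r h.succ) (fun h => π h.succ) y := by
  simp [totalReward, Fin.sum_univ_succ (n := H)]

section Value

variable [Fintype S]

theorem sum_pi_fin_succ (F : (Fin (H + 1) → S) → ℝ) :
    ∑ y, F y = ∑ s, ∑ y : Fin H → S, F (Fin.cons s y) := by
  rw [← Fintype.sum_prod_type', ← (Fin.consEquiv fun _ : Fin (H + 1) => S).sum_comp]
  rfl

theorem sum_trajProb {P : Model S A H} (hP : ∀ h s a, P h s a ∈ stdSimplex ℝ S)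
    (π : Policy S A H) (s : S) :
    ∑ y : Fin H → S, trajProb P π (Fin.cons s y : Fin (H + 1) → S) = 1 := by
  induction H generalizing s with
  | zero => simp [trajProb]
  | succ H ih =>
    rw [sum_pi_fin_succ]
    simp_rw [trajProb_cons_cons, ← Finset.mul_sum]
    rw [← (hP 0 s (π 0 s)).2]
    refine Finset.sum_congr rfl fun s' _ => ?_
    rw [ih (P := fun h => P h.succ) (fun h => hP h.succ), mul_one]

theorem value_zero (r : Fin 0 → S → A → ℝ) (P : Model S A 0) (π : Policy S A 0) (s : S) :
    value r P π s = 0 := by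
  simp [value, totalReward]

/-- The Bellman equation for the first step of a policy. -/
theorem value_succ (r : Fin (H + 1) → S → A → ℝ) {P : Model S A (H + 1)}
    (hP : ∀ h s a, P h s a ∈ stdSimplex ℝ S) (π : Policy S A (H + 1)) (s : S) :
    value r P π s = r 0 s (π 0 s) + ∑ s', P 0 s (π 0 s) s' *
      value (fun h => r h.succ) (fun h => P h.succ) (fun h => π h.succ) s' := by
  have h1 := sum_trajProb hP π s
  rw [value]
  simp_rw [totalReward_cons, mul_add, Finset.sum_add_distrib, ← Finset.sum_mul, h1, one_mul]
  congr 1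
  rw [sum_pi_fin_succ]
  simp_rw [trajProb_cons_cons, value, Finset.mul_sum, mul_assoc]

/-- Averaging against a probability vector preserves a constant error, so the one-step errors simply
add up. -/
theorem value_le_of_step {r : Fin H → S → A → ℝ} {P : Model S A H}
    (hP : ∀ h s a, P h s a ∈ stdSimplex ℝ S) {π : Policy S A H} {V : Fin (H + 1) → S → ℝ}
    {c : ℝ} (hlast : ∀ s, 0 ≤ V (Fin.last H) s)
    (hstep : ∀ h s, r h s (π h s) + ∑ s', P h s (π h s) s' * V h.succ s' ≤
      V h.castSucc s + c) (s : S) :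
    value r P π s ≤ V 0 s + H * c := by
  induction H generalizing s with
  | zero => simpa [value_zero] using hlast s
  | succ H ih =>
    have ih' := ih (r := fun h => r h.succ) (P := fun h => P h.succ) (fun h => hP h.succ)
      (π := fun h => π h.succ) (V := fun k => V k.succ) hlast
      (fun h s => by simpa only [Fin.succ_castSucc] using hstep h.succ s)
    rw [value_succ r hP]
    have h1 := expect_mono (hP 0 s (π 0 s)) ih'
    rw [expect_add_const _ _ (hP 0 s (π 0 s))] at h1
    have h2 := hstep 0 s
    rw [Fin.castSucc_zero] at h2
    push_cast
    linarith

theorem le_value_of_step {r : Fin H → S → A → ℝ} {P : Model S A H}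
    (hP : ∀ h s a, P h s a ∈ stdSimplex ℝ S) {π : Policy S A H} {V : Fin (H + 1) → S → ℝ}
    {c : ℝ} (hlast : ∀ s, V (Fin.last H) s ≤ 0)
    (hstep : ∀ h s, V h.castSucc s ≤
      r h s (π h s) + ∑ s', P h s (π h s) s' * V h.succ s' + c) (s : S) :
    V 0 s - H * c ≤ value r P π s := by
  -- Negating rewards and `V` reduces the claim to the upper bound.
  have hneg : value (fun h s a => -r h s a) P π s = -value r P π s := by
    simp [value, totalReward]
  have := value_le_of_step (r := fun h s a => -r h s a) hP (π := π) (V := fun k s => -V k s)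
    (c := c) (fun s => by linarith [hlast s])
    (fun h s => by simp only [mul_neg, Finset.sum_neg_distrib]; linarith [hstep h s]) s
  linarith

theorem value_nonneg {r : Fin H → S → A → ℝ} (hr : ∀ h s a, 0 ≤ r h s a) {P : Model S A H}
    (hP : ∀ h s a, P h s a ∈ stdSimplex ℝ S) (π : Policy S A H) (s : S) :
    0 ≤ value r P π s :=
  Finset.sum_nonneg fun _ _ => mul_nonneg (Finset.prod_nonneg fun _ _ => (hP _ _ _).1 _)
    (Finset.sum_nonneg fun _ _ => hr _ _ _)

end Value

/-! ### Robust backward induction -/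

section DP

variable [Fintype S] [MetricSpace S]

theorem robustDP_last (p ρ : ℝ) (r : Fin H → S → A → ℝ) (P : Model S A H) :
    robustDP p ρ r P (Fin.last H) = fun _ => 0 :=
  Fin.reverseInduction_last ..

theorem robustDP_castSucc (p ρ : ℝ) (r : Fin H → S → A → ℝ) (P : Model S A H) (h : Fin H) :
    robustDP p ρ r P h.castSucc = fun s => ⨆ a, robustQ p ρ r P h (robustDP p ρ r P h.succ) s a :=
  Fin.reverseInduction_castSucc ..

/-- Backward induction from step `k` on uses the model only from step `k` on. -/
theorem robustDP_congr (p ρ : ℝ) (r : Fin H → S → A → ℝ) {P Q : Model S A H} (k : Fin (H + 1))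
    (h : ∀ i : Fin H, k ≤ i.castSucc → P i = Q i) :
    robustDP p ρ r P k = robustDP p ρ r Q k := by
  induction k using Fin.reverseInduction with
  | last => simp only [robustDP_last]
  | cast i ih =>
    have ih' := ih fun j hj => h j (i.castSucc_lt_succ.le.trans hj)
    simp only [robustDP_castSucc, robustQ, ih', h i le_rfl]

theorem robustDP_mem_Icc [Nonempty A] [Finite A] {p ρ : ℝ} (hp : 0 < p) (hρ : 0 ≤ ρ)
    {r : Fin H → S → A → ℝ} (hr : ∀ h s a, r h s a ∈ Set.Icc (0 : ℝ) 1) {P : Model S A H}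
    (hP : ∀ h s a, P h s a ∈ stdSimplex ℝ S) (k : Fin (H + 1)) (s : S) :
    robustDP p ρ r P k s ∈ Set.Icc (0 : ℝ) (H - k) := by
  induction k using Fin.reverseInduction generalizing s with
  | last => simp [robustDP_last]
  | cast i ih =>
    rw [robustDP_castSucc]
    have hmem : ∀ a, robustQ p ρ r P i (robustDP p ρ r P i.succ) s a ∈
        Set.Icc (0 : ℝ) (H - (i.castSucc : Fin (H + 1))) := fun a => by
      have h0 := worstCase_nonneg (wassersteinBall_subset p ρ (P i s a)) fun s' => (ih s').1
      obtain ⟨Q, hQ⟩ := wassersteinBall_nonempty hp hρ (hP i s a)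
      have h1 := worstCase_le (wassersteinBall_subset p ρ (P i s a)) (fun s' => (ih s').1) hQ
      have h2 := expect_le hQ.1 fun s' => (ih s').2
      have h3 := hr i s a
      simp only [Fin.val_succ, Fin.val_castSucc, Nat.cast_add, Nat.cast_one] at h2 ⊢
      exact ⟨add_nonneg h3.1 h0, by unfold robustQ; linarith [h3.2]⟩
    exact ⟨Real.iSup_nonneg fun a => (hmem a).1, ciSup_le fun a => (hmem a).2⟩

/-- If the robust one-step look-aheads of `P₀` and `Q` are `η`-close along the backward induction
for `Q`, then a policy that is greedy for `Q` is `2 H η`-optimal for `P₀`. -/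
theorem norm_optRobustValue_sub_le [Nonempty A] [Finite A] {p ρ η : ℝ} (hp : 0 < p)
    (hρ : 0 ≤ ρ) (hη : 0 ≤ η) {r : Fin H → S → A → ℝ}
    (hr : ∀ h s a, r h s a ∈ Set.Icc (0 : ℝ) 1) {P₀ Q : Model S A H}
    (hP₀ : ∀ h s a, P₀ h s a ∈ stdSimplex ℝ S) (hQ : ∀ h s a, Q h s a ∈ stdSimplex ℝ S)
    (hle : ∀ h s a, worstCase (wassersteinBall p ρ (P₀ h s a)) (robustDP p ρ r Q h.succ) ≤
      worstCase (wassersteinBall p ρ (Q h s a)) (robustDP p ρ r Q h.succ) + η)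
    (hge : ∀ h s a, worstCase (wassersteinBall p ρ (Q h s a)) (robustDP p ρ r Q h.succ) ≤
      worstCase (wassersteinBall p ρ (P₀ h s a)) (robustDP p ρ r Q h.succ) + η)
    {π : Policy S A H}
    (hπ : ∀ h s a, robustQ p ρ r Q h (robustDP p ρ r Q h.succ) s a ≤
      robustQ p ρ r Q h (robustDP p ρ r Q h.succ) s (π h s)) :
    ‖optRobustValue p ρ r P₀ - robustValue p ρ r P₀ π‖ ≤ 2 * H * η := by
  have hbdd : ∀ (σ : Policy S A H) s,
      BddBelow ((fun P => value r P σ s) '' uncertaintySet p ρ P₀) := fun σ s =>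
    ⟨0, by
      rintro _ ⟨P, hP, rfl⟩
      exact value_nonneg (fun h s a => (hr h s a).1) (fun h s a => (hP h s a).1) σ s⟩
  have hne : (uncertaintySet p ρ P₀).Nonempty := by
    choose P hP using fun h s a => wassersteinBall_nonempty hp hρ (hP₀ h s a)
    exact ⟨P, hP⟩
  have hV0 : ∀ k s, 0 ≤ robustDP p ρ r Q k s := fun k s =>
    (robustDP_mem_Icc hp hρ hr hQ k s).1
  have hup : ∀ (σ : Policy S A H) s, robustValue p ρ r P₀ σ s ≤ robustDP p ρ r Q 0 s + H * η := by
    intro σ s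
    refine le_of_forall_pos_le_add fun ξ hξ => ?_
    have hξ' : 0 < ξ / (H + 1) := by positivity
    -- Rectangularity: near-worst distributions chosen separately for each `(h,s,a)` form one model
    -- in the uncertainty set.
    choose P hP hlt using fun h s a => exists_lt_worstCase_add
      (wassersteinBall_nonempty hp hρ (hP₀ h s a)) (robustDP p ρ r Q h.succ) hξ'
    have h1 : robustValue p ρ r P₀ σ s ≤ value r P σ s := csInf_le (hbdd σ s) ⟨P, hP, rfl⟩
    have h2 := value_le_of_step (r := r) (fun h s a => (hP h s a).1) (π := σ)
      (V := robustDP p ρ r Q) (c := η + ξ / (H + 1)) (hV0 _)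
      (fun h s => by
        have e1 : robustQ p ρ r Q h (robustDP p ρ r Q h.succ) s (σ h s) ≤
            robustDP p ρ r Q h.castSucc s := by
          rw [robustDP_castSucc]
          exact le_ciSup (f := fun a => robustQ p ρ r Q h (robustDP p ρ r Q h.succ) s a)
            (Set.finite_range _).bddAbove (σ h s)
        have e2 := hlt h s (σ h s)
        have e3 := hle h s (σ h s)
        unfold robustQ at e1
        linarith) s
    have h3 : H * (ξ / (H + 1)) ≤ ξ := by
      rw [mul_div_assoc', div_le_iff₀ (by positivity)]
      nlinarith
    linarith
  have hlow : ∀ s, robustDP p ρ r Q 0 s - H * η ≤ robustValue p ρ r P₀ π s := by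
    intro s
    refine le_csInf (hne.image _) ?_
    rintro _ ⟨P, hP, rfl⟩
    refine le_value_of_step (fun h s a => (hP h s a).1) (V := robustDP p ρ r Q)
      (by simp [robustDP_last]) (fun h s => ?_) s
    rw [robustDP_castSucc]
    refine (ciSup_le (hπ h s)).trans ?_
    have e1 := worstCase_le (wassersteinBall_subset p ρ _) (hV0 h.succ) (hP h s (π h s))
    have e2 := hge h s (π h s)
    unfold robustQ
    linarith
  rw [pi_norm_le_iff_of_nonneg (by positivity)]
  intro s
  have : Nonempty (Policy S A H) := ⟨π⟩
  have h1 : optRobustValue p ρ r P₀ s ≤ robustDP p ρ r Q 0 s + H * η := ciSup_le fun σ => hup σ s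
  have h2 : robustValue p ρ r P₀ π s ≤ optRobustValue p ρ r P₀ s :=
    le_ciSup (f := fun σ : Policy S A H => robustValue p ρ r P₀ σ s)
      (Set.finite_range _).bddAbove π
  rw [Pi.sub_apply, Real.norm_of_nonneg (sub_nonneg.2 h2)]
  linarith [hlow s]

end DP

/-! ### The empirical model -/

section Empirical

variable [Fintype S]

theorem sum_empiricalModel_mul (D : Fin H → S → A → Fin N → S) (h : Fin H) (s : S) (a : A)
    (f : S → ℝ) :
    ∑ s', empiricalModel D h s a s' * f s' = (∑ i, f (D h s a i)) / N := by
  classical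
  rw [← Finset.sum_fiberwise Finset.univ (fun i => D h s a i), Finset.sum_div]
  refine Finset.sum_congr rfl fun s' _ => ?_
  rw [Finset.sum_congr rfl (g := fun _ => f s') (by simp +contextual), Finset.sum_const,
    nsmul_eq_mul, empiricalModel, div_mul_eq_mul_div]

theorem empiricalModel_mem (hN : 0 < N) (D : Fin H → S → A → Fin N → S) (h : Fin H) (s : S)
    (a : A) : empiricalModel D h s a ∈ stdSimplex ℝ S := by
  refine ⟨fun s' => by unfold empiricalModel; positivity, ?_⟩
  have := sum_empiricalModel_mul D h s a fun _ => 1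
  simp only [mul_one, Finset.sum_const, Finset.card_univ, Fintype.card_fin, nsmul_eq_mul] at this
  rw [this, div_self (by positivity)]

end Empirical

/-! ### Independence and Hoeffding's inequality -/

section Probability

open MeasureTheory ProbabilityTheory

variable {Ω : Type*} [MeasurableSpace Ω] {μ : Measure Ω} [IsProbabilityMeasure μ]

/-- A bound on `μ {Z ∈ B y}` for all fixed `y` persists when `y` is replaced by a random variable
independent of `Z`. -/
theorem measureReal_le_of_indepFun {α β : Type*} [Fintype α] [MeasurableSpace α]
    [MeasurableSingletonClass α] [Finite β] [MeasurableSpace β] [MeasurableSingletonClass β]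
    {Y : Ω → α} {Z : Ω → β} (hYZ : IndepFun Y Z μ) (hY : Measurable Y) (B : α → Set β) {c : ℝ}
    (hB : ∀ y, μ.real {ω | Z ω ∈ B y} ≤ c) : μ.real {ω | Z ω ∈ B (Y ω)} ≤ c := by
  have hsub : {ω | Z ω ∈ B (Y ω)} ⊆ ⋃ y, Y ⁻¹' {y} ∩ Z ⁻¹' B y := fun ω hω => by
    simpa using hω
  calc μ.real {ω | Z ω ∈ B (Y ω)} ≤ μ.real (⋃ y, Y ⁻¹' {y} ∩ Z ⁻¹' B y) := measureReal_mono hsub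
    _ ≤ ∑ y, μ.real (Y ⁻¹' {y} ∩ Z ⁻¹' B y) := measureReal_iUnion_fintype_le _
    _ = ∑ y, μ.real (Y ⁻¹' {y}) * μ.real (Z ⁻¹' B y) := by
        refine Finset.sum_congr rfl fun y _ => ?_
        simp only [measureReal_def, ← ENNReal.toReal_mul]
        rw [hYZ.measure_inter_preimage_eq_mul _ _ (measurableSet_singleton y)
          (Set.toFinite _).measurableSet]
    _ ≤ ∑ y, μ.real (Y ⁻¹' {y}) * c := by
        gcongr with y
        exact hB y
    _ = c := by
        rw [← Finset.sum_mul, sum_measureReal_preimage_singleton _ fun y _ =>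
          hY (measurableSet_singleton y)]
        simp

/-- Hoeffding's inequality for the empirical mean of `f` over an i.i.d. sample from a finite
set. -/
theorem measureReal_mean_ge_le [Fintype S] [MeasurableSpace S] [MeasurableSingletonClass S]
    {X : Fin N → Ω → S} (hX : ∀ i, Measurable (X i)) (hindep : iIndepFun X μ) {P : S → ℝ}
    (hlaw : ∀ i s, μ.real {ω | X i ω = s} = P s) (hN : 0 < N) {f : S → ℝ} {M : ℝ} (hM : 0 < M)
    (hf : ∀ s, f s ∈ Set.Icc 0 M) {t : ℝ} (ht : 0 ≤ t) :
    μ.real {ω | ∑ s, P s * f s + t ≤ (∑ i, f (X i ω)) / N} ≤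
      Real.exp (-(2 * N * t ^ 2 / M ^ 2)) := by
  have hfm : Measurable f := measurable_of_finite f
  have hmean : ∀ i, ∫ ω, f (X i ω) ∂μ = ∑ s, P s * f s := fun i => by
    rw [← integral_map (hX i).aemeasurable hfm.aestronglyMeasurable,
      integral_fintype (Integrable.of_finite)]
    refine Finset.sum_congr rfl fun s _ => ?_
    rw [map_measureReal_apply (hX i) (measurableSet_singleton s), smul_eq_mul, ← hlaw i s]
    rfl
  have hsub : ∀ i, HasSubgaussianMGF (fun ω => f (X i ω) - ∑ s, P s * f s)
      ((‖M - 0‖₊ / 2) ^ 2) μ := fun i => by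
    rw [← hmean i]
    exact hasSubgaussianMGF_of_mem_Icc (hfm.comp (hX i)).aemeasurable
      (Filter.Eventually.of_forall fun ω => hf _)
  have hind : iIndepFun (fun i ω => f (X i ω) - ∑ s, P s * f s) μ :=
    hindep.comp (fun _ s => f s - ∑ s, P s * f s) fun _ => measurable_of_finite _
  have hNt : 0 ≤ N * t := by positivity
  have key := HasSubgaussianMGF.measure_sum_ge_le_of_iIndepFun hind
    (s := Finset.univ) (fun i _ => hsub i) hNt
  have hset : {ω | ∑ s, P s * f s + t ≤ (∑ i, f (X i ω)) / N} =
      {ω | N * t ≤ ∑ i, (f (X i ω) - ∑ s, P s * f s)} := by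
    ext ω
    have hN' : (0 : ℝ) < N := by positivity
    simp only [Set.mem_ofPred_eq, le_div_iff₀ hN', Finset.sum_sub_distrib, Finset.sum_const,
      Finset.card_univ, Fintype.card_fin, nsmul_eq_mul]
    constructor <;> intro h <;> linarith
  rw [hset]
  refine key.trans (le_of_eq ?_)
  congr 1
  simp only [Finset.sum_const, Finset.card_univ, Fintype.card_fin, nsmul_eq_mul, sub_zero,
    NNReal.coe_mul, NNReal.coe_pow, NNReal.coe_div, coe_nnnorm, Real.norm_of_nonneg hM.le,
    NNReal.coe_natCast, NNReal.coe_ofNat]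
  have hN' : (N : ℝ) ≠ 0 := by positivity
  field_simp

end Probability

/-! ### Sample-size arithmetic -/

theorem one_lt_log_arg {H nS nA B R δ ε : ℝ} (hH : 1 ≤ H) (hnS : 1 ≤ nS) (hnA : 1 ≤ nA)
    (hB : 0 ≤ B) (hR : 0 < R) (hδ : δ ∈ Set.Ioo (0 : ℝ) 1) (hε : ε ∈ Set.Ioo 0 H) :
    1 < 16 * H ^ 2 * nS * nA * (H * B + max H R) / (R * δ * ε) := by
  obtain ⟨hδ0, hδ1⟩ := hδ
  obtain ⟨hε0, hε1⟩ := hε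
  rw [one_lt_div (by positivity)]
  have hHB : 0 ≤ H * B := by positivity
  have hmax : R ≤ H * B + max H R := by linarith [le_max_right H R]
  calc R * δ * ε ≤ R * 1 * ε := by gcongr
    _ < R * 1 * H := by gcongr
    _ = 1 * H * 1 * 1 * R := by ring
    _ ≤ 16 * H ^ 2 * nS * nA * (H * B + max H R) := by
        gcongr
        · norm_num
        · exact le_self_pow₀ hH two_ne_zero

/-- With the prescribed number of samples per state, action and step, the union bound over a grid
of `G` points succeeds. -/
theorem union_bound_le {H N nS nA B p ρ δ ε : ℝ} {G : ℝ} (hH : 1 ≤ H) (hnS : 1 ≤ nS)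
    (hnA : 1 ≤ nA) (hB : 0 ≤ B) (hρ : 0 < ρ) (hδ : δ ∈ Set.Ioo (0 : ℝ) 1) (hε : ε ∈ Set.Ioo 0 H)
    (hG : G ≤ 4 * H * (H * B + max H (ρ ^ p)) / (ρ ^ p * ε))
    (hN : sampleBound H nS nA B p ρ δ ε ≤ N * nS * nA * H) :
    H * nS * nA * G * 2 * Real.exp (-(2 * N * (ε / (4 * H)) ^ 2 / H ^ 2)) ≤ δ := by
  have hR : 0 < ρ ^ p := by positivity
  have hlog := one_lt_log_arg hH hnS hnA hB hR hδ hε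
  have hδ0 := hδ.1
  have hε0 := hε.1
  have hH0 : 0 < H := by linarith
  have hS0 : 0 < nS := by linarith
  have hA0 : 0 < nA := by linarith
  have hρ2 : ρ ^ (2 * p) = (ρ ^ p) ^ 2 := by
    rw [mul_comm, Real.rpow_mul hρ.le]
    norm_cast
  rw [sampleBound, hρ2] at hN
  set R := ρ ^ p
  set K := H * B + max H R with hK
  have hKpos : 0 < K := by
    have : 0 < max H R := lt_max_of_lt_left hH0
    positivity
  set L := Real.log (16 * H ^ 2 * nS * nA * K / (R * δ * ε)) with hL
  have hL0 : 0 ≤ L := Real.log_nonneg hlog.le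
  have hexp : L ≤ 2 * N * (ε / (4 * H)) ^ 2 / H ^ 2 := by
    have e1 : 8 * H ^ 5 * nS * nA * (B + R) ^ 2 / (R ^ 2 * ε ^ 2) * L =
        (8 * H ^ 4 * ((B + R) ^ 2 / R ^ 2) / ε ^ 2 * L) * (nS * nA * H) := by
      field_simp
    have e2 : 8 * H ^ 4 * ((B + R) ^ 2 / R ^ 2) / ε ^ 2 * L ≤ N := by
      refine le_of_mul_le_mul_right ?_ (show 0 < nS * nA * H by positivity)
      linarith
    -- The factor `(B + R) ^ 2 / R ^ 2` of the sample bound is only needed to be at least `1`,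
    -- because the test functions have range `H`.
    have e3 : 1 ≤ (B + R) ^ 2 / R ^ 2 := by
      rw [one_le_div (by positivity)]
      gcongr
      linarith
    have e4 : 8 * H ^ 4 * 1 / ε ^ 2 * L ≤ N := le_trans (by gcongr) e2
    calc L = 2 * (8 * H ^ 4 * 1 / ε ^ 2 * L) * (ε / (4 * H)) ^ 2 / H ^ 2 := by
          field_simp
          ring
      _ ≤ _ := by gcongr
  have hle : Real.exp (-(2 * N * (ε / (4 * H)) ^ 2 / H ^ 2)) ≤
      R * δ * ε / (16 * H ^ 2 * nS * nA * K) := by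
    calc _ ≤ Real.exp (-L) := Real.exp_le_exp.2 (neg_le_neg hexp)
      _ = _ := by
        rw [Real.exp_neg, hL, Real.exp_log (by linarith), inv_div]
  calc _ ≤ H * nS * nA * (4 * H * K / (R * ε)) * 2 * (R * δ * ε / (16 * H ^ 2 * nS * nA * K)) := by
        gcongr
    _ = δ / 2 := by
        field_simp
        norm_num
    _ ≤ δ := by linarith

/-- The extra grid point adds `R * ε ≤ R * H` to the numerator, which the term with `max H R`
absorbs. -/
theorem floor_grid_le {H B R ε : ℝ} (hH : 1 ≤ H) (hB : 0 ≤ B) (hR : 0 < R)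
    (hε : ε ∈ Set.Ioo 0 H) :
    ((⌊H / R / (ε / (4 * H * B + H))⌋₊ + 1 : ℕ) : ℝ) ≤ 4 * H * (H * B + max H R) / (R * ε) := by
  obtain ⟨hε0, hε1⟩ := hε
  have hH0 : 0 < H := by linarith
  push_cast
  have h1 := Nat.floor_le (show 0 ≤ H / R / (ε / (4 * H * B + H)) by positivity)
  have h2 : H / R / (ε / (4 * H * B + H)) + 1 = (4 * H ^ 2 * B + H * H + R * ε) / (R * ε) := by
    field_simp
  have h3 : (4 * H ^ 2 * B + H * H + R * ε) / (R * ε) ≤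
      4 * H * (H * B + max H R) / (R * ε) := by
    gcongr
    nlinarith [le_max_left H R, le_max_right H R, mul_le_mul_of_nonneg_left hε1.le hR.le,
      mul_le_mul_of_nonneg_left (le_max_left H R) hH0.le,
      mul_le_mul_of_nonneg_left (le_max_right H R) hH0.le]
  linarith

/-! ### Concentration along the backward induction -/

section Probability

open MeasureTheory ProbabilityTheory

variable [Fintype S] [Nonempty S] [MetricSpace S] [MeasurableSpace S] [MeasurableSingletonClass S]
  [Fintype A] [Nonempty A] {Ω : Type*} [MeasurableSpace Ω] {μ : Measure Ω}
  [IsProbabilityMeasure μ]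

/-- Concentration of the empirical next-state expectation at step `h` for a test function that
depends on the backward induction after step `h`: the latter is independent of the samples of
step `h`. -/
theorem measureReal_empirical_ge_le {p ρ : ℝ} (hp : 0 < p) (hρ : 0 ≤ ρ)
    {r : Fin H → S → A → ℝ} (hr : ∀ h s a, r h s a ∈ Set.Icc (0 : ℝ) 1) {P₀ : Model S A H}
    {X : Fin H → S → A → Fin N → Ω → S} (hX : ∀ h s a i, Measurable (X h s a i))
    (hlaw : ∀ h s a i s', μ.real {ω | X h s a i ω = s'} = P₀ h s a s')
    (hindep : iIndepFun
      (fun k : Fin H × S × A × Fin N => X k.1 k.2.1 k.2.2.1 k.2.2.2) μ)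
    (hN : 0 < N) (hH : 0 < H) (h : Fin H) (s : S) (a : A) (F : (S → ℝ) → S → ℝ)
    (hF : ∀ V : S → ℝ, (∀ s, V s ∈ Set.Icc (0 : ℝ) H) → ∀ s, F V s ∈ Set.Icc (0 : ℝ) H)
    {t : ℝ} (ht : 0 ≤ t) :
    μ.real {ω | ∑ s', P₀ h s a s' *
        F (robustDP p ρ r (empiricalModel fun h s a i => X h s a i ω) h.succ) s' + t ≤
      ∑ s', empiricalModel (fun h s a i => X h s a i ω) h s a s' *
        F (robustDP p ρ r (empiricalModel fun h s a i => X h s a i ω) h.succ) s'} ≤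
      Real.exp (-(2 * N * t ^ 2 / (H : ℝ) ^ 2)) := by
  classical
  let later : Finset (Fin H × S × A × Fin N) := Finset.univ.filter fun k => h < k.1
  let now : Finset (Fin H × S × A × Fin N) := Finset.univ.filter fun k => k.1 = h
  have hdisj : Disjoint later now :=
    Finset.disjoint_filter.2 fun k _ h1 h2 => h1.ne' h2
  have hXm : ∀ k : Fin H × S × A × Fin N, Measurable (X k.1 k.2.1 k.2.2.1 k.2.2.2) :=
    fun k => hX _ _ _ _
  have hind := hindep.indepFun_finset later now hdisj hXm
  let s₀ : S := Classical.arbitrary S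
  -- The filler `s₀` at steps up to `h` is harmless: backward induction from `h.succ` never reads
  -- those samples.
  let data (y : later → S) : Fin H → S → A → Fin N → S := fun h' s a i =>
    if hk : (h', s, a, i) ∈ later then y ⟨(h', s, a, i), hk⟩ else s₀
  let V (y : later → S) : S → ℝ := robustDP p ρ r (empiricalModel (data y)) h.succ
  have hmem : ∀ i, (h, s, a, i) ∈ now := fun i => by simp [now]
  let B (y : later → S) : Set (now → S) := {z | ∑ s', P₀ h s a s' * F (V y) s' + t ≤
    (∑ i, F (V y) (z ⟨(h, s, a, i), hmem i⟩)) / N}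
  have hV : ∀ ω, robustDP p ρ r (empiricalModel fun h s a i => X h s a i ω) h.succ =
      V fun k => X k.1.1 k.1.2.1 k.1.2.2.1 k.1.2.2.2 ω := fun ω => by
    refine robustDP_congr p ρ r _ fun j hj => ?_
    have hj' : h < j := Fin.succ_le_castSucc_iff.1 hj
    have hdata : (data fun k => X k.1.1 k.1.2.1 k.1.2.2.1 k.1.2.2.2 ω) j =
        fun s a i => X j s a i ω := by
      funext s a i
      simp [data, later, hj']
    funext s a s'
    simp only [empiricalModel, hdata]
  have hbound : ∀ y, μ.real {ω | (fun k : now => X k.1.1 k.1.2.1 k.1.2.2.1 k.1.2.2.2 ω) ∈ B y} ≤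
      Real.exp (-(2 * N * t ^ 2 / (H : ℝ) ^ 2)) := fun y =>
    measureReal_mean_ge_le (X := X h s a) (hX h s a)
      (hindep.precomp (g := fun i => (h, s, a, i)) fun i j hij => by simpa using hij)
      (hlaw h s a) hN (by positivity)
      (hF _ fun s => by
        have := robustDP_mem_Icc hp hρ hr (empiricalModel_mem hN (data y)) h.succ s
        exact ⟨this.1, this.2.trans (sub_le_self _ (Nat.cast_nonneg _))⟩) ht
  clear_value V
  have hle := measureReal_le_of_indepFun hind (measurable_pi_iff.2 fun k => hXm k) B hbound
  refine le_trans (measureReal_mono fun ω hω => ?_) hle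
  rw [Set.mem_ofPred_eq, hV ω, sum_empiricalModel_mul] at hω
  exact hω

end Probability

end RPVL

end

theorem theorem5 {S A Ω : Type*} [Fintype S] [Nonempty S] [MetricSpace S]
    [MeasurableSpace S] [MeasurableSingletonClass S] [Fintype A] [Nonempty A]
    (H N : ℕ) (p ρ δ ε : ℝ) (hp : 1 ≤ p) (hρ : 0 < ρ)
    (hδ : δ ∈ Set.Ioo (0 : ℝ) 1) (hε : ε ∈ Set.Ioo (0 : ℝ) (H : ℝ))
    (r : Fin H → S → A → ℝ) (hr : ∀ h s a, r h s a ∈ Set.Icc (0 : ℝ) 1)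
    (P₀ : RPVL.Model S A H) (hP₀ : ∀ h s a, P₀ h s a ∈ stdSimplex ℝ S)
    [MeasurableSpace Ω] (μ : MeasureTheory.Measure Ω) [MeasureTheory.IsProbabilityMeasure μ]
    (X : Fin H → S → A → Fin N → Ω → S)
    (hX : ∀ h s a i, Measurable (X h s a i))
    (hlaw : ∀ h s a i s', μ.real {ω | X h s a i ω = s'} = P₀ h s a s')
    (hindep : ProbabilityTheory.iIndepFun
      (fun k : Fin H × S × A × Fin N => X k.1 k.2.1 k.2.2.1 k.2.2.2) μ)
    (hN : RPVL.sampleBound H (Fintype.card S) (Fintype.card A) (RPVL.maxDistPow S p) p ρ δ ε ≤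
      (N : ℝ) * Fintype.card S * Fintype.card A * H) :
    1 - δ ≤ μ.real {ω | ∀ πhat : RPVL.Policy S A H,
      RPVL.IsOutput p ρ r (fun h s a i => X h s a i ω) πhat →
        ‖RPVL.optRobustValue p ρ r P₀ - RPVL.robustValue p ρ r P₀ πhat‖ ≤ ε} := by
  open RPVL in
  have hp0 : 0 < p := by linarith
  have hε0 := hε.1
  have hH : 0 < H := by
    have := hε.1.trans hε.2
    exact_mod_cast this
  have hH1 : (1 : ℝ) ≤ H := by exact_mod_cast hH
  have hH0 : (0 : ℝ) < H := by linarith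
  have hS1 : (1 : ℝ) ≤ Fintype.card S := by exact_mod_cast Fintype.card_pos
  have hA1 : (1 : ℝ) ≤ Fintype.card A := by exact_mod_cast Fintype.card_pos
  have hB : 0 ≤ maxDistPow S p := maxDistPow_nonneg p
  have hR : 0 < ρ ^ p := by positivity
  -- For `N = 0` the empirical frequencies would not sum to one; positivity of the sample bound
  -- excludes this.
  have hNpos : 0 < N := by
    refine Nat.pos_of_ne_zero fun h0 => ?_
    have hpos : 0 < sampleBound H (Fintype.card S) (Fintype.card A) (maxDistPow S p) p ρ δ ε :=
      mul_pos (by positivity) (Real.log_pos (one_lt_log_arg hH1 hS1 hA1 hB hR hδ hε))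
    rw [h0] at hN
    simp only [Nat.cast_zero, zero_mul] at hN
    linarith
  set B := maxDistPow S p
  -- The mesh makes `θ * B ≤ t`; the summand `H` keeps the denominator positive when `B = 0`.
  set θ : ℝ := ε / (4 * H * B + H) with hθ
  set t : ℝ := ε / (4 * H) with ht
  set G : ℕ := ⌊(H : ℝ) / ρ ^ p / θ⌋₊ + 1 with hG
  have hθ0 : 0 < θ := by positivity
  have ht0 : 0 ≤ t := by positivity
  have hθB : θ * B ≤ t := by
    rw [hθ, ht, div_mul_eq_mul_div, div_le_div_iff₀ (by positivity) (by positivity)]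
    nlinarith [mul_pos hε0 hH0]
  have hΛ : (H : ℝ) / ρ ^ p < θ * G := by
    have := Nat.lt_floor_add_one ((H : ℝ) / ρ ^ p / θ)
    rw [div_lt_iff₀ hθ0] at this
    rw [hG]
    push_cast
    linarith
  let Phat (ω : Ω) : Model S A H := empiricalModel fun h s a i => X h s a i ω
  let V (ω : Ω) (h : Fin H) : S → ℝ := robustDP p ρ r (Phat ω) h.succ
  -- Reflecting in `[0, H]` lets the upper-tail bound control both signs of the deviation.
  let test (b : Bool) (j : ℕ) (W : S → ℝ) (y : S) : ℝ :=
    if b then cTransform p W (θ * j) y else H - cTransform p W (θ * j) y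
  have htest : ∀ b j (W : S → ℝ), (∀ s, W s ∈ Set.Icc (0 : ℝ) H) →
      ∀ s, test b j W s ∈ Set.Icc (0 : ℝ) H := fun b j W hW s => by
    have := cTransform_mem_Icc hp0 hW (l := θ * j) (by positivity) s
    cases b
    · exact ⟨sub_nonneg.2 this.2, sub_le_self _ this.1⟩
    · exact this
  let bad (k : Fin H × S × A × Fin G × Bool) : Set Ω :=
    {ω | ∑ s', P₀ k.1 k.2.1 k.2.2.1 s' * test k.2.2.2.2 k.2.2.2.1 (V ω k.1) s' + t ≤
      ∑ s', Phat ω k.1 k.2.1 k.2.2.1 s' * test k.2.2.2.2 k.2.2.2.1 (V ω k.1) s'}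
  have hbad : ∀ k, μ.real (bad k) ≤ Real.exp (-(2 * N * t ^ 2 / (H : ℝ) ^ 2)) := fun k =>
    measureReal_empirical_ge_le hp0 hρ.le hr hX hlaw hindep hNpos hH k.1 k.2.1 k.2.2.1
      (test k.2.2.2.2 k.2.2.2.1) (htest _ _) ht0
  have hunion : μ.real (⋃ k, bad k) ≤ δ := by
    calc μ.real (⋃ k, bad k) ≤ ∑ k, μ.real (bad k) := MeasureTheory.measureReal_iUnion_fintype_le _
      _ ≤ ∑ _k : Fin H × S × A × Fin G × Bool, Real.exp (-(2 * N * t ^ 2 / (H : ℝ) ^ 2)) :=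
          Finset.sum_le_sum fun k _ => hbad k
      _ = H * Fintype.card S * Fintype.card A * G * 2 *
            Real.exp (-(2 * N * t ^ 2 / (H : ℝ) ^ 2)) := by
          simp only [Finset.sum_const, Finset.card_univ, Fintype.card_prod, Fintype.card_fin,
            Fintype.card_bool, nsmul_eq_mul]
          push_cast
          ring
      _ ≤ δ := union_bound_le hH1 hS1 hA1 hB hρ hδ hε (floor_grid_le hH1 hB hR hε) hN
  set good : Set Ω := {ω | ∀ πhat : Policy S A H,
      IsOutput p ρ r (fun h s a i => X h s a i ω) πhat →
        ‖optRobustValue p ρ r P₀ - robustValue p ρ r P₀ πhat‖ ≤ ε}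
  -- Covering the whole space and using subadditivity avoids any measurability claim about `good`.
  have hgood : (Set.univ : Set Ω) ⊆ good ∪ ⋃ k, bad k := by
    intro ω _
    refine or_iff_not_imp_right.2 fun hω => ?_
    have hPhat : ∀ h s a, Phat ω h s a ∈ stdSimplex ℝ S := empiricalModel_mem hNpos _
    have hV : ∀ h s, V ω h s ∈ Set.Icc (0 : ℝ) H := fun h s => by
      have := robustDP_mem_Icc hp0 hρ.le hr hPhat h.succ s
      exact ⟨this.1, this.2.trans (sub_le_self _ (Nat.cast_nonneg _))⟩
    have hlt : ∀ h s a (j : Fin G) b, ∑ s', Phat ω h s a s' * test b j (V ω h) s' <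
        ∑ s', P₀ h s a s' * test b j (V ω h) s' + t := fun h s a j b => by
      by_contra hcon
      exact hω (Set.mem_iUnion.2 ⟨(h, s, a, j, b), not_lt.1 hcon⟩)
    have hbelow : ∀ h s a, ∀ j < G,
        ∑ y, Phat ω h s a y * cTransform p (V ω h) (θ * j) y ≤
          ∑ y, P₀ h s a y * cTransform p (V ω h) (θ * j) y + t := fun h s a j hj => by
      simpa [test] using (hlt h s a ⟨j, hj⟩ true).le
    have habove : ∀ h s a, ∀ j < G,
        ∑ y, P₀ h s a y * cTransform p (V ω h) (θ * j) y ≤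
          ∑ y, Phat ω h s a y * cTransform p (V ω h) (θ * j) y + t := fun h s a j hj => by
      have := (hlt h s a ⟨j, hj⟩ false).le
      simp only [test, Bool.false_eq_true, if_false, mul_sub, Finset.sum_sub_distrib,
        ← Finset.sum_mul, (hP₀ h s a).2, (hPhat h s a).2] at this
      linarith
    intro πhat hπ
    refine (norm_optRobustValue_sub_le hp0 hρ.le (η := t + θ * B) (by positivity) hr hP₀ hPhat
      (fun h s a => ?_) (fun h s a => ?_) hπ).trans ?_
    · exact worstCase_le_add hp0 hρ (hP₀ h s a) (hPhat h s a) (hV h) fun l hl =>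
        expect_cTransform_le_of_grid p (hP₀ h s a) (hPhat h s a) _ hθ0 hΛ (habove h s a) hl
    · exact worstCase_le_add hp0 hρ (hPhat h s a) (hP₀ h s a) (hV h) fun l hl =>
        expect_cTransform_le_of_grid p (hPhat h s a) (hP₀ h s a) _ hθ0 hΛ (hbelow h s a) hl
    · calc 2 * H * (t + θ * B) ≤ 2 * H * (t + t) := by gcongr
        _ = ε := by
          rw [ht]
          field_simp
          norm_num
  have h1 := MeasureTheory.measureReal_mono (μ := μ) hgood
  have h2 := MeasureTheory.measureReal_union_le (μ := μ) good (⋃ k, bad k)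
  rw [MeasureTheory.probReal_univ] at h1
  linarith
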